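/- Let $p$ be a prime and let $d\ge 3$, $e\ge 5$, $k\ge 1$, $n\ge 3$ be integers. Let $R=R_{e,k}$ be the Galois ring of characteristic $p^e$ and rank $k$, that is, $R\cong(\mathbb Z/p^e\mathbb Z)[x]/(f)$ where $f$ is monic of degree $k$ and irreducible modulo $p$, and let $E\subset R^d$. For $x,y\in R^d$ write $x\cdot y=\sum_{i=1}^d x_iy_i$. Let $T$ be a forest (a finite simple graph without cycles, isolated vertices allowed) with vertex set $V$, $|V|=m$, and edge set $\mathcal F$, $|\mathcal F|=n$, and let $\alpha=(\alpha_\varepsilon)_{\varepsilon\in\mathcal F}$ be arbitrary elements of $R$. Put $$\Pi_\alpha(T)=\{(x_v)_{v\in V}\in E^{V} : x_u\cdot x_v=\alpha_{\{u,v\}}\text{ for every edge }\{u,v\}\in\mathcal F\}.$$ If $$|E|\ \ge\ \max\left\{2n\sqrt{6+3e}\;p^{\,dek-\frac{dk}{2}+\frac{3ek}{2}+\frac k2},\ \ \sqrt{14e}\;p^{\,dek-\frac{dk}{2}+\frac{nek}{2}+\frac n2-\frac{ek}{2}+\frac k2}\right\},$$ then $$|\Pi_\alpha(T)|\ \le\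 \frac{2|E|^m}{p^{nek}}.$$ -/

import Mathlib

open Polynomial

/-- `R` is a Galois ring `R_{e,k}` of characteristic `p ^ e` and rank `k`: it is isomorphic to
`(ℤ / p ^ e)[X] / (f)` for some monic `f` of degree `k` whose reduction mod `p` is irreducible. -/
def IsGaloisRing (p e k : ℕ) (R : Type*) [CommRing R] : Prop :=
  ∃ (he : e ≠ 0) (f : (ZMod (p ^ e))[X]),
    f.Monic ∧ f.natDegree = k ∧
      Irreducible (f.map (ZMod.castHom (dvd_pow_self p he) (ZMod p))) ∧
      Nonempty (R ≃+* AdjoinRoot f)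

/-- The set `Π_α(T)` of all assignments of a point of `E ⊆ R ^ d` to every vertex of the graph `T`
(repetitions allowed) such that the points at the two ends of each edge `ε` have dot product
`α ε`. -/
def dotConfigurations {R V : Type*} [CommRing R] {d : ℕ} (T : SimpleGraph V)
    (α : T.edgeSet → R) (E : Finset (Fin d → R)) : Set (V → Fin d → R) :=
  {x | (∀ v, x v ∈ E) ∧
    ∀ (u v : V) (h : T.Adj u v), x u ⬝ᵥ x v = α ⟨s(u, v), T.mem_edgeSet.mpr h⟩}

/-!
Write `N = |R| = p ^ (e * k)` and `Q = p ^ k`. The indicator of `x ⬝ᵥ y = α` is `N⁻¹ + κ(x, y)`,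
where the perturbation `κ` is small in mean square: for every `E ⊆ R ^ d`,
`∑ x ∈ E, (∑ y ∈ E, κ(x, y)) ^ 2 ≤ L * |E|` with `L * Q ^ (d - 1) = (e + 1) * N ^ (2 * d - 1)`
(`IsGaloisRing.sum_sq_incidence_discrepancy_le`). To see this, expand `κ` in the nontrivial additive
characters of `R`, apply the Cauchy–Schwarz inequality, and use that the exponential sum of `E` for
the character `ψ` has total square at most `N ^ d * |E| * |I_ψ| ^ d`, with `I_ψ` the largest ideal in
the kernel of `ψ`. Such an ideal consists of nonunits, of which a Galois ring has at most
`Q ^ (e - 1)`, and the sizes of all the `I_ψ` add up to the number of pairs `(a, b)` with `a * b = 0`,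
at most `(e + 1) * N`.

The number of configurations is at most the sum over `E ^ V` of the product over the edges of
`N⁻¹ + κ`. Expanding it over subsets `S` of the edge set, the empty `S` gives the main term
`|E| ^ m / N ^ n`. A single edge contributes at most `η * |E| ^ m` with `η = √L / |E|`
(`sum_edge_le`). If `S` has at least two edges, then, being acyclic, it has two leaves that are not
joined to each other; summing over these leaves first and bounding the remaining factors by `1` gives
at most `η ^ 2 * |E| ^ m` (`sum_prod_edges_le`). Hence the count is at most
`|E| ^ m / N ^ n * (1 + n * η * N + η ^ 2 * (N + 1) ^ n)` (`sum_prod_forest_le`), and the two lower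
bounds on `|E|` make each of the two error terms at most `1 / 2` (`error_terms_le`).
-/

/-! ### Leaves of finite forests -/

/-- A vertex other than a prescribed vertex `u` that has exactly one neighbour exists in every finite
acyclic graph with an edge: it is the end of a longest path starting at `u`, or at `a` when `u` is
isolated. -/
lemma SimpleGraph.IsAcyclic.exists_leaf_ne {V : Type*} [Finite V] {G : SimpleGraph V}
    (hG : G.IsAcyclic) {a b : V} (hab : G.Adj a b) (u : V) :
    ∃ l w, l ≠ u ∧ G.Adj l w ∧ ∀ w', G.Adj l w' → w' = w := by
  classical
  have := Fintype.ofFinite V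
  obtain ⟨r, r', hr, hru⟩ : ∃ r r', G.Adj r r' ∧ (r = u ∨ ∀ w, ¬ G.Adj u w) := by
    by_cases h : ∃ w, G.Adj u w
    · obtain ⟨w, hw⟩ := h
      exact ⟨u, w, hw, Or.inl rfl⟩
    · exact ⟨a, b, hab, Or.inr (not_exists.mp h)⟩
  let P : ℕ → Prop := fun n => ∃ (v : V) (w : G.Walk r v), w.IsPath ∧ w.length = n
  have hP1 : P 1 := ⟨r', hr.toWalk, by simp [Walk.isPath_def, hr.ne], by simp⟩
  have hbound : ∀ n, P n → n ≤ Fintype.card V := by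
    rintro n ⟨v, w, hw, rfl⟩
    exact hw.length_lt.le
  have hc : 1 ≤ Fintype.card V := hbound 1 hP1
  set n := Nat.findGreatest P (Fintype.card V) with hn
  have h1n : 1 ≤ n := Nat.le_findGreatest hc hP1
  obtain ⟨v, w, hw, hwn⟩ : P n := Nat.findGreatest_spec hc hP1
  have hvr : v ≠ r := by
    rintro rfl
    have := Walk.length_eq_zero_iff.mpr (Walk.isPath_iff_nil.mp hw)
    omega
  have hnil : ¬ w.Nil := fun h => hvr h.eq.symm
  have hadj := (w.adj_penultimate hnil).symm
  refine ⟨v, w.penultimate, ?_, hadj, ?_⟩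
  · rcases hru with h | h
    · exact h ▸ hvr
    · rintro rfl
      exact h _ hadj
  · intro w' hw'
    by_cases hs : w' ∈ w.support
    · exact hG.eq_penultimate_of_adj_end hw hw' hs
    · exfalso
      have hQ : P (n + 1) := ⟨w', w.concat hw', hw.concat hs hw', by simp [hwn]⟩
      have := Nat.le_findGreatest (hbound _ hQ) hQ
      omega

/-- An acyclic set of at least two edges has two distinct leaves, neither of which is the neighbour
of the other. -/
lemma exists_two_leaves {V : Type*} [Finite V] {S : Finset (Sym2 V)}
    (hS : (SimpleGraph.fromEdgeSet (S : Set (Sym2 V))).IsAcyclic)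
    (hdiag : ∀ e ∈ S, ¬ e.IsDiag) (hcard : 2 ≤ S.card) :
    ∃ l₁ u₁ l₂ u₂ : V, s(l₁, u₁) ∈ S ∧ s(l₂, u₂) ∈ S ∧ l₁ ≠ l₂ ∧ l₁ ≠ u₁ ∧ l₁ ≠ u₂ ∧
      l₂ ≠ u₁ ∧ l₂ ≠ u₂ ∧ (∀ e ∈ S, l₁ ∈ e → e = s(l₁, u₁)) ∧
      (∀ e ∈ S, l₂ ∈ e → e = s(l₂, u₂)) := by
  classical
  have key : ∀ S' ⊆ S, S'.Nonempty → ∀ u : V, ∃ l w, l ≠ u ∧ l ≠ w ∧ s(l, w) ∈ S' ∧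
      ∀ e ∈ S', l ∈ e → e = s(l, w) := by
    intro S' hS' ⟨e, he⟩ u
    induction e with | _ a b
    have hab : (SimpleGraph.fromEdgeSet (S' : Set (Sym2 V))).Adj a b := by
      rw [SimpleGraph.fromEdgeSet_adj]
      exact ⟨he, by simpa using hdiag _ (hS' he)⟩
    have hac := hS.anti (SimpleGraph.fromEdgeSet_mono (Finset.coe_subset.mpr hS'))
    obtain ⟨l, w, hlu, hlw, huniq⟩ := hac.exists_leaf_ne hab u
    rw [SimpleGraph.fromEdgeSet_adj] at hlw
    refine ⟨l, w, hlu, hlw.2, hlw.1, ?_⟩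
    intro e he hle
    obtain ⟨w', rfl⟩ := hle
    have : w' = w := huniq w' (by
      rw [SimpleGraph.fromEdgeSet_adj]
      exact ⟨he, by simpa using hdiag _ (hS' he)⟩)
    rw [this]
  obtain ⟨e₀, he₀⟩ : S.Nonempty := Finset.card_pos.mp (by omega)
  obtain ⟨l₁, u₁, -, h11, hm1, hu1⟩ := key S subset_rfl ⟨e₀, he₀⟩ e₀.out.1
  have hne : (S.erase s(l₁, u₁)).Nonempty := by
    rw [← Finset.card_pos, Finset.card_erase_of_mem hm1]; omega
  obtain ⟨l₂, u₂, h21, h22, hm2, hu2⟩ := key _ (Finset.erase_subset _ _) hne u₁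
  have hm2' := Finset.mem_erase.mp hm2
  have hl12 : l₁ ≠ l₂ := by
    rintro rfl
    exact hm2'.1 (hu1 _ hm2'.2 (Sym2.mem_mk_left _ _))
  have hl1u2 : l₁ ≠ u₂ := by
    rintro rfl
    exact hm2'.1 (hu1 _ hm2'.2 (Sym2.mem_mk_right _ _))
  refine ⟨l₁, u₁, l₂, u₂, hm1, hm2'.2, hl12, h11, hl1u2, h21, h22, hu1, ?_⟩
  intro e he hle
  by_cases h : e = s(l₁, u₁)
  · subst h
    rw [Sym2.mem_iff] at hle
    rcases hle with h | h
    · exact absurd h.symm hl12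
    · exact absurd h h21
  · exact hu2 e (Finset.mem_erase.mpr ⟨h, he⟩) hle

/-! ### Weighted counts of forests -/

section Sums

variable {V X : Type*} [Fintype V] [DecidableEq V]

/-- Resampling one coordinate of a point of `E ^ V` preserves the uniform distribution. -/
lemma card_mul_sum_piFinset (E : Finset X) (l : V) (F : (V → X) → ℝ) :
    (E.card : ℝ) * ∑ x ∈ Fintype.piFinset (fun _ : V => E), F x =
      ∑ x ∈ Fintype.piFinset (fun _ : V => E), ∑ y ∈ E, F (Function.update x l y) := by
  classical
  have h : (E.card : ℝ) * ∑ x ∈ Fintype.piFinset (fun _ : V => E), F x =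
      ∑ x ∈ Fintype.piFinset (fun _ : V => E), ∑ _y ∈ E, F x := by
    simp [Finset.mul_sum]
  rw [h, ← Finset.sum_product', ← Finset.sum_product']
  have hmem : ∀ a ∈ Fintype.piFinset (fun _ : V => E) ×ˢ E,
      (Function.update a.1 l a.2, a.1 l) ∈ Fintype.piFinset (fun _ : V => E) ×ˢ E := by
    rintro ⟨x, y⟩ hxy
    simp only [Finset.mem_product, Fintype.mem_piFinset] at hxy ⊢
    refine ⟨fun v => ?_, hxy.1 l⟩
    by_cases hv : v = l
    · subst hv; simpa using hxy.2
    · simpa [hv] using hxy.1 v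
  exact Finset.sum_nbij' (fun a => (Function.update a.1 l a.2, a.1 l))
    (fun a => (Function.update a.1 l a.2, a.1 l)) hmem hmem
    (fun a _ => by simp) (fun a _ => by simp) (fun a _ => by simp)

lemma card_mul_sum_piFinset_apply (E : Finset X) (u : V) (g : X → ℝ) :
    (E.card : ℝ) * ∑ x ∈ Fintype.piFinset (fun _ : V => E), g (x u) =
      (E.card : ℝ) ^ Fintype.card V * ∑ z ∈ E, g z := by
  rw [card_mul_sum_piFinset E u]
  simp [Fintype.card_piFinset]

/-- The mean square of a function of one coordinate, from its mean square over `E`. -/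
lemma sum_piFinset_sq_le {E : Finset X} (hE : E.Nonempty) {A : X → ℝ} {c : ℝ}
    (hA : ∑ z ∈ E, A z ^ 2 ≤ c * E.card) (u : V) :
    ∑ x ∈ Fintype.piFinset (fun _ : V => E), A (x u) ^ 2 ≤ (E.card : ℝ) ^ Fintype.card V * c := by
  have hpos : (0 : ℝ) < E.card := by exact_mod_cast hE.card_pos
  have h := card_mul_sum_piFinset_apply E u (fun z => A z ^ 2)
  have h2 := mul_le_mul_of_nonneg_left hA (pow_nonneg hpos.le (Fintype.card V))
  refine le_of_mul_le_mul_left ?_ hpos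
  rw [h]
  linarith

/-- A single edge: the mean over `E ^ V` of a kernel evaluated along the edge is at most `η` when
its partial means have mean square at most `η ^ 2`. -/
lemma sum_edge_le {E : Finset X} (hE : E.Nonempty) {κ : Sym2 X → ℝ} {η : ℝ} (hη : 0 ≤ η)
    (hκ : ∑ z ∈ E, (∑ y ∈ E, κ s(y, z)) ^ 2 ≤ (η * E.card) ^ 2 * E.card) {a b : V} (hab : a ≠ b) :
    ∑ x ∈ Fintype.piFinset (fun _ : V => E), κ s(x a, x b) ≤ (E.card : ℝ) ^ Fintype.card V * η := by
  have hpos : (0 : ℝ) < E.card := by exact_mod_cast hE.card_pos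
  have h1 := card_mul_sum_piFinset E a (fun x : V → X => κ s(x a, x b))
  simp only [Function.update_self, Function.update_of_ne hab.symm] at h1
  have h2 := sum_piFinset_sq_le hE hκ b
  have h3 := sq_sum_le_card_mul_sum_sq (s := Fintype.piFinset (fun _ : V => E))
    (f := fun x => ∑ y ∈ E, κ s(y, x b))
  rw [← h1, Fintype.card_piFinset] at h3
  simp only [Finset.prod_const, Finset.card_univ, Nat.cast_pow] at h3
  refine le_of_mul_le_mul_left ?_ hpos
  refine abs_le_of_sq_le_sq' ?_ (by positivity) |>.2
  calc _ ≤ _ := h3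
    _ ≤ (E.card : ℝ) ^ Fintype.card V *
        ((E.card : ℝ) ^ Fintype.card V * (η * E.card) ^ 2) := by gcongr
    _ = _ := by ring

/-- At least two edges: summing over two leaves first, the rest of the product is at most `1` in
absolute value, so the mean gains two factors `η`. -/
lemma sum_prod_edges_le {E : Finset X} (hE : E.Nonempty) {S : Finset (Sym2 V)}
    (hS : (SimpleGraph.fromEdgeSet (S : Set (Sym2 V))).IsAcyclic)
    (hdiag : ∀ e ∈ S, ¬ e.IsDiag) (hcard : 2 ≤ S.card)
    {κ : Sym2 V → Sym2 X → ℝ} (hκ1 : ∀ e z, |κ e z| ≤ 1) {η : ℝ}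
    (hκ : ∀ e ∈ S, ∑ z ∈ E, (∑ y ∈ E, κ e s(y, z)) ^ 2 ≤ (η * E.card) ^ 2 * E.card) :
    ∑ x ∈ Fintype.piFinset (fun _ : V => E), ∏ e ∈ S, κ e (e.map x) ≤
      (E.card : ℝ) ^ Fintype.card V * η ^ 2 := by
  have hpos : (0 : ℝ) < E.card := by exact_mod_cast hE.card_pos
  obtain ⟨l₁, u₁, l₂, u₂, hm1, hm2, h12, h1u1, h1u2, h2u1, h2u2, hu1, hu2⟩ :=
    exists_two_leaves hS hdiag hcard
  have hne : s(l₁, u₁) ≠ s(l₂, u₂) := by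
    intro h
    have : l₁ ∈ s(l₂, u₂) := h ▸ Sym2.mem_mk_left _ _
    rcases Sym2.mem_iff.mp this with h | h
    · exact h12 h
    · exact h1u2 h
  set C := (S.erase s(l₁, u₁)).erase s(l₂, u₂) with hC
  have hm2' : s(l₂, u₂) ∈ S.erase s(l₁, u₁) := Finset.mem_erase.mpr ⟨hne.symm, hm2⟩
  have hsplit : ∀ x : V → X, ∏ e ∈ S, κ e (e.map x) =
      κ s(l₁, u₁) s(x l₁, x u₁) * (κ s(l₂, u₂) s(x l₂, x u₂) * ∏ e ∈ C, κ e (e.map x)) := by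
    intro x
    rw [← Finset.mul_prod_erase S _ hm1, ← Finset.mul_prod_erase _ _ hm2']
    simp [hC]
  have hcore : ∀ (x : V → X) y z,
      ∏ e ∈ C, κ e (e.map (Function.update (Function.update x l₁ y) l₂ z)) =
        ∏ e ∈ C, κ e (e.map x) := by
    intro x y z
    refine Finset.prod_congr rfl fun e he => ?_
    congr 1
    refine Sym2.map_congr fun v hv => ?_
    have he' := Finset.mem_erase.mp he
    have he'' := Finset.mem_erase.mp he'.2
    have hv1 : v ≠ l₁ := by rintro rfl; exact he''.1 (hu1 e he''.2 hv)
    have hv2 : v ≠ l₂ := by rintro rfl; exact he'.1 (hu2 e he''.2 hv)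
    simp [hv1, hv2]
  set A : X → ℝ := fun z => ∑ y ∈ E, κ s(l₁, u₁) s(y, z)
  set B : X → ℝ := fun z => ∑ y ∈ E, κ s(l₂, u₂) s(y, z)
  have hsum : (E.card : ℝ) * ((E.card : ℝ) *
      ∑ x ∈ Fintype.piFinset (fun _ : V => E), ∏ e ∈ S, κ e (e.map x)) =
      ∑ x ∈ Fintype.piFinset (fun _ : V => E),
        A (x u₁) * (B (x u₂) * ∏ e ∈ C, κ e (e.map x)) := by
    rw [card_mul_sum_piFinset E l₂, card_mul_sum_piFinset E l₁]
    refine Finset.sum_congr rfl fun x _ => ?_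
    simp only [hsplit, hcore, A, B]
    simp only [Function.update_self, Function.update_of_ne h12, Function.update_of_ne h1u1.symm,
      Function.update_of_ne h2u1.symm, Function.update_of_ne h1u2.symm,
      Function.update_of_ne h2u2.symm, Finset.sum_mul, Finset.mul_sum]
    rw [Finset.sum_comm]
  have hpt : ∀ x : V → X, A (x u₁) * (B (x u₂) * ∏ e ∈ C, κ e (e.map x)) ≤
      2⁻¹ * (A (x u₁) ^ 2 + B (x u₂) ^ 2) := by
    intro x
    have hc : |∏ e ∈ C, κ e (e.map x)| ≤ 1 := by
      rw [Finset.abs_prod]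
      exact Finset.prod_le_one (fun _ _ => abs_nonneg _) (fun _ _ => hκ1 _ _)
    calc A (x u₁) * (B (x u₂) * ∏ e ∈ C, κ e (e.map x))
        ≤ |A (x u₁) * (B (x u₂) * ∏ e ∈ C, κ e (e.map x))| := le_abs_self _
      _ = |A (x u₁)| * |B (x u₂)| * |∏ e ∈ C, κ e (e.map x)| := by
        rw [abs_mul, abs_mul, mul_assoc]
      _ ≤ |A (x u₁)| * |B (x u₂)| * 1 := by gcongr
      _ ≤ 2⁻¹ * (A (x u₁) ^ 2 + B (x u₂) ^ 2) := by
        rw [← sq_abs (A _), ← sq_abs (B _)]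
        nlinarith [sq_nonneg (|A (x u₁)| - |B (x u₂)|)]
  have hA := sum_piFinset_sq_le hE (hκ _ hm1) u₁
  have hB := sum_piFinset_sq_le hE (hκ _ hm2) u₂
  refine le_of_mul_le_mul_left (le_of_mul_le_mul_left ?_ hpos) hpos
  rw [hsum]
  calc _ ≤ ∑ x ∈ Fintype.piFinset (fun _ : V => E), 2⁻¹ * (A (x u₁) ^ 2 + B (x u₂) ^ 2) :=
        Finset.sum_le_sum fun x _ => hpt x
    _ = 2⁻¹ * (∑ x ∈ Fintype.piFinset (fun _ : V => E), A (x u₁) ^ 2 +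
        ∑ x ∈ Fintype.piFinset (fun _ : V => E), B (x u₂) ^ 2) := by
      rw [← Finset.mul_sum, Finset.sum_add_distrib]
    _ ≤ 2⁻¹ * ((E.card : ℝ) ^ Fintype.card V * (η * E.card) ^ 2 +
        (E.card : ℝ) ^ Fintype.card V * (η * E.card) ^ 2) := by gcongr
    _ = _ := by ring

/-- The weighted count of homomorphic images of a forest, for edge weights `δ + κ e` with a constant
main part `δ` and a perturbation `κ e` of mean-square size `η`. -/
theorem sum_prod_forest_le {E : Finset X} (hE : E.Nonempty) {S : Finset (Sym2 V)}
    (hS : (SimpleGraph.fromEdgeSet (S : Set (Sym2 V))).IsAcyclic)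
    (hdiag : ∀ e ∈ S, ¬ e.IsDiag)
    {κ : Sym2 V → Sym2 X → ℝ} (hκ1 : ∀ e z, |κ e z| ≤ 1) {η δ : ℝ} (hη : 0 ≤ η) (hδ : 0 ≤ δ)
    (hκ : ∀ e ∈ S, ∑ z ∈ E, (∑ y ∈ E, κ e s(y, z)) ^ 2 ≤ (η * E.card) ^ 2 * E.card) :
    ∑ x ∈ Fintype.piFinset (fun _ : V => E), ∏ e ∈ S, (κ e (e.map x) + δ) ≤
      (E.card : ℝ) ^ Fintype.card V *
        (δ ^ S.card + S.card * (η * δ ^ (S.card - 1)) + η ^ 2 * (1 + δ) ^ S.card) := by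
  set M := (E.card : ℝ) ^ Fintype.card V with hM
  have hM0 : 0 ≤ M := by positivity
  have hterm : ∀ t ∈ S.powerset,
      (∑ x ∈ Fintype.piFinset (fun _ : V => E), ∏ e ∈ t, κ e (e.map x)) * δ ^ (S.card - t.card) ≤
      M * ((if t.card = 0 then δ ^ S.card else 0) +
        (if t.card = 1 then η * δ ^ (S.card - 1) else 0) +
        η ^ 2 * (1 ^ t.card * δ ^ (S.card - t.card))) := by
    intro t ht
    rw [Finset.mem_powerset] at ht
    have hnn : 0 ≤ η ^ 2 * δ ^ (S.card - t.card) := by positivity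
    rcases Nat.lt_or_ge t.card 2 with h | h
    · interval_cases h' : t.card
      · rw [Finset.card_eq_zero] at h'
        subst h'
        have : (∑ x ∈ Fintype.piFinset (fun _ : V => E), ∏ e ∈ (∅ : Finset (Sym2 V)),
            κ e (e.map x)) = M := by simp [hM, Fintype.card_piFinset]
        rw [this]
        refine mul_le_mul_of_nonneg_left ?_ hM0
        simp only [if_true, Nat.sub_zero] at hnn ⊢
        norm_num
        exact hnn
      · obtain ⟨e, rfl⟩ := Finset.card_eq_one.mp h'
        have he : e ∈ S := ht (Finset.mem_singleton_self e)
        have := hκ e he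
        have hd := hdiag e he
        induction e with | _ a b
        have h1 := sum_edge_le (V := V) hE hη this (by simpa using hd : a ≠ b)
        simp only [Finset.prod_singleton, Sym2.map_mk]
        calc _ ≤ (M * η) * δ ^ (S.card - 1) := by gcongr
          _ = M * (η * δ ^ (S.card - 1)) := by ring
          _ ≤ _ := by
            refine mul_le_mul_of_nonneg_left ?_ hM0
            norm_num
            exact hnn
    · have h1 := sum_prod_edges_le hE
        (hS.anti (SimpleGraph.fromEdgeSet_mono (Finset.coe_subset.mpr ht)))
        (fun e he => hdiag e (ht he)) h hκ1 (fun e he => hκ e (ht he))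
      rw [if_neg (by omega), if_neg (by omega)]
      calc _ ≤ (M * η ^ 2) * δ ^ (S.card - t.card) := by gcongr
        _ = _ := by ring
  calc ∑ x ∈ Fintype.piFinset (fun _ : V => E), ∏ e ∈ S, (κ e (e.map x) + δ)
      = ∑ t ∈ S.powerset, (∑ x ∈ Fintype.piFinset (fun _ : V => E), ∏ e ∈ t, κ e (e.map x)) *
          δ ^ (S.card - t.card) := by
        simp only [Finset.prod_add]
        rw [Finset.sum_comm]
        refine Finset.sum_congr rfl fun t ht => ?_
        rw [Finset.sum_mul]
        simp [Finset.card_sdiff_of_subset (Finset.mem_powerset.mp ht)]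
    _ ≤ _ := Finset.sum_le_sum hterm
    _ = _ := by
      rw [← Finset.mul_sum, Finset.sum_add_distrib, Finset.sum_add_distrib, ← Finset.mul_sum,
        Finset.sum_pow_mul_eq_add_pow]
      congr 3
      · rw [Finset.sum_ite, Finset.sum_const_zero, add_zero, Finset.sum_const,
          ← Finset.powersetCard_eq_filter]
        simp
      · rw [Finset.sum_ite, Finset.sum_const_zero, add_zero, Finset.sum_const,
          ← Finset.powersetCard_eq_filter]
        simp

end Sums

/-! ### Incidence discrepancy over finite commutative rings -/

section Fourier

variable {R : Type*} [CommRing R] [Fintype R]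

open Classical in
/-- The largest ideal contained in the kernel of the additive character `ψ`, as a finite set. -/
noncomputable def kernelIdeal (ψ : AddChar R ℂ) : Finset R :=
  Finset.univ.filter fun a => ∀ r, ψ (a * r) = 1

lemma mem_kernelIdeal {ψ : AddChar R ℂ} {a : R} : a ∈ kernelIdeal ψ ↔ ∀ r, ψ (a * r) = 1 := by
  simp [kernelIdeal]

open Classical in
lemma sum_mul_eq_ite (ψ : AddChar R ℂ) (a : R) :
    ∑ r, ψ (a * r) = if a ∈ kernelIdeal ψ then (Fintype.card R : ℂ) else 0 := by
  have h := AddChar.sum_eq_ite (AddChar.mulShift ψ a)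
  simp only [AddChar.mulShift_apply] at h
  rw [h]
  have : AddChar.mulShift ψ a = 0 ↔ a ∈ kernelIdeal ψ := by
    rw [mem_kernelIdeal, AddChar.eq_zero_iff]
    simp
  simp [this]

/-- Averaged over all characters, the size of `kernelIdeal ψ` is measured by the pairs of elements
with product zero. -/
lemma sum_card_kernelIdeal :
    ∑ ψ : AddChar R ℂ, (kernelIdeal ψ).card = Nat.card {ab : R × R // ab.1 * ab.2 = 0} := by
  classical
  have hN : (Fintype.card R : ℂ) ≠ 0 := by exact_mod_cast Fintype.card_ne_zero
  have h1 : ∑ ψ : AddChar R ℂ, ∑ a, ∑ r, ψ (a * r) =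
      (Fintype.card R : ℂ) * ∑ ψ : AddChar R ℂ, ((kernelIdeal ψ).card : ℂ) := by
    rw [Finset.mul_sum]
    refine Finset.sum_congr rfl fun ψ _ => ?_
    simp only [sum_mul_eq_ite]
    rw [← Finset.sum_filter]
    simp [mul_comm]
  have h2 : ∑ ψ : AddChar R ℂ, ∑ a, ∑ r, ψ (a * r) =
      (Fintype.card R : ℂ) * (Nat.card {ab : R × R // ab.1 * ab.2 = 0} : ℂ) := by
    rw [Finset.sum_comm, Nat.card_eq_fintype_card, Fintype.card_subtype]
    have : ∀ a : R, ∑ ψ : AddChar R ℂ, ∑ r, ψ (a * r) =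
        ∑ r, if a * r = 0 then (Fintype.card R : ℂ) else 0 := by
      intro a
      rw [Finset.sum_comm]
      exact Finset.sum_congr rfl fun r _ => AddChar.sum_apply_eq_ite _
    simp only [this]
    rw [← Fintype.sum_prod_type', ← Finset.sum_filter]
    simp [mul_comm]
  have h3 := mul_left_cancel₀ hN (h1.symm.trans h2)
  exact_mod_cast h3

open Classical in
/-- The kernel ideal of a nontrivial character contains no unit. -/
lemma card_kernelIdeal_le {ψ : AddChar R ℂ} (hψ : ψ ≠ 0) :
    (kernelIdeal ψ).card ≤ Nat.card {a : R // ¬ IsUnit a} := by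
  rw [Nat.card_eq_fintype_card, Fintype.card_subtype]
  refine Finset.card_le_card fun a ha => ?_
  rw [mem_kernelIdeal] at ha
  simp only [Finset.mem_filter, Finset.mem_univ, true_and]
  rintro ⟨u, rfl⟩
  refine hψ (AddChar.eq_zero_iff.mpr fun x => ?_)
  simpa using ha (↑u⁻¹ * x)

variable {d : ℕ}

open Classical in
lemma sum_dotProduct_eq_ite (ψ : AddChar R ℂ) (z : Fin d → R) :
    ∑ x : Fin d → R, ψ (x ⬝ᵥ z) =
      if ∀ i, z i ∈ kernelIdeal ψ then (Fintype.card R : ℂ) ^ d else 0 := by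
  have h : ∀ x : Fin d → R, ψ (x ⬝ᵥ z) = ∏ i, ψ (z i * x i) := by
    intro x
    have h' := map_prod ψ.toMonoidHom (fun i => Multiplicative.ofAdd (x i * z i)) Finset.univ
    rw [← ofAdd_sum] at h'
    simp only [AddChar.toMonoidHom_apply, toAdd_ofAdd] at h'
    rw [dotProduct, h']
    exact Finset.prod_congr rfl fun i _ => by rw [mul_comm]
  simp only [h]
  rw [← Fintype.prod_sum (fun i r => ψ (z i * r))]
  simp only [sum_mul_eq_ite]
  rw [Finset.prod_ite_zero]
  simp

/-- Plancherel: the exponential sum over `E` has mean square at most `|E| |I| ^ d`, where `I` is the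
largest ideal on which the character is trivial. -/
lemma sum_norm_sq_exponential_le (ψ : AddChar R ℂ) (E : Finset (Fin d → R)) (α : R) :
    ∑ x : Fin d → R, ‖∑ y ∈ E, ψ (x ⬝ᵥ y - α)‖ ^ 2 ≤
      (Fintype.card R : ℝ) ^ d * (E.card * ((kernelIdeal ψ).card : ℝ) ^ d) := by
  classical
  have hsq : ∀ x : Fin d → R, ((‖∑ y ∈ E, ψ (x ⬝ᵥ y - α)‖ ^ 2 : ℝ) : ℂ) =
      ∑ y ∈ E, ∑ y' ∈ E, ψ (x ⬝ᵥ (y - y')) := by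
    intro x
    rw [Complex.ofReal_pow, ← Complex.mul_conj', map_sum, Finset.sum_mul_sum]
    refine Finset.sum_congr rfl fun y _ => Finset.sum_congr rfl fun y' _ => ?_
    rw [← AddChar.map_neg_eq_conj, ← AddChar.map_add_eq_mul, dotProduct_sub]
    congr 1
    ring
  have hsum : ((∑ x : Fin d → R, ‖∑ y ∈ E, ψ (x ⬝ᵥ y - α)‖ ^ 2 : ℝ) : ℂ) =
      ∑ y ∈ E, ∑ y' ∈ E,
        if ∀ i, (y - y') i ∈ kernelIdeal ψ then (Fintype.card R : ℂ) ^ d else 0 := by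
    rw [Complex.ofReal_sum]
    simp only [hsq]
    rw [Finset.sum_comm]
    refine Finset.sum_congr rfl fun y _ => ?_
    rw [Finset.sum_comm]
    exact Finset.sum_congr rfl fun y' _ => sum_dotProduct_eq_ite ψ _
  have hsum' : (∑ x : Fin d → R, ‖∑ y ∈ E, ψ (x ⬝ᵥ y - α)‖ ^ 2 : ℝ) =
      ∑ y ∈ E, ∑ y' ∈ E,
        if ∀ i, (y - y') i ∈ kernelIdeal ψ then (Fintype.card R : ℝ) ^ d else 0 := by
    apply Complex.ofReal_injective
    rw [hsum]
    push_cast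
    simp only [apply_ite Complex.ofReal, Complex.ofReal_zero, Complex.ofReal_pow,
      Complex.ofReal_natCast]
  rw [hsum', show (Fintype.card R : ℝ) ^ d * (E.card * ((kernelIdeal ψ).card : ℝ) ^ d) =
    ∑ _y ∈ E, ((kernelIdeal ψ).card : ℝ) ^ d * (Fintype.card R : ℝ) ^ d by simp; ring]
  refine Finset.sum_le_sum fun y _ => ?_
  rw [← Finset.sum_filter, Finset.sum_const, nsmul_eq_mul]
  refine mul_le_mul_of_nonneg_right ?_ (by positivity)
  have : (E.filter fun y' => ∀ i, (y - y') i ∈ kernelIdeal ψ).card ≤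
      (Fintype.piFinset fun _ : Fin d => kernelIdeal ψ).card := by
    refine Finset.card_le_card_of_injOn (fun y' => y - y') ?_ ?_
    · intro y' hy'
      simpa using (Finset.mem_filter.mp hy').2
    · intro a _ b _ hab
      simpa using hab
  rw [Fintype.card_piFinset] at this
  simp only [Finset.prod_const, Finset.card_univ, Fintype.card_fin] at this
  exact_mod_cast this

open Classical in
/-- Pointwise Fourier expansion of the incidence discrepancy: the trivial character cancels the mean
value, and the remaining ones are combined by the Cauchy–Schwarz inequality. -/
lemma sq_incidence_discrepancy_le (E : Finset (Fin d → R)) (α : R) (x : Fin d → R) :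
    (∑ y ∈ E, ((if x ⬝ᵥ y = α then (1 : ℝ) else 0) - (Fintype.card R : ℝ)⁻¹)) ^ 2 ≤
      (Fintype.card R : ℝ)⁻¹ *
        ∑ ψ ∈ Finset.univ.erase (0 : AddChar R ℂ), ‖∑ y ∈ E, ψ (x ⬝ᵥ y - α)‖ ^ 2 := by
  have hN : (0 : ℝ) < Fintype.card R := by exact_mod_cast Fintype.card_pos
  have hNC : (Fintype.card R : ℂ) ≠ 0 := by exact_mod_cast hN.ne'
  have hcard : ((Finset.univ.erase (0 : AddChar R ℂ)).card : ℝ) ≤ Fintype.card R := by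
    have h1 : (Finset.univ.erase (0 : AddChar R ℂ)).card ≤ Fintype.card (AddChar R ℂ) :=
      Finset.card_le_univ _
    rw [AddChar.card_eq] at h1
    exact_mod_cast h1
  have hexp : ((∑ y ∈ E, ((if x ⬝ᵥ y = α then (1 : ℝ) else 0) - (Fintype.card R : ℝ)⁻¹) : ℝ) : ℂ) =
      (Fintype.card R : ℂ)⁻¹ *
        ∑ ψ ∈ Finset.univ.erase (0 : AddChar R ℂ), ∑ y ∈ E, ψ (x ⬝ᵥ y - α) := by
    rw [Finset.sum_comm, Finset.mul_sum, Complex.ofReal_sum]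
    refine Finset.sum_congr rfl fun y _ => ?_
    have h := AddChar.sum_apply_eq_ite (x ⬝ᵥ y - α)
    rw [← Finset.add_sum_erase _ _ (Finset.mem_univ (0 : AddChar R ℂ)), AddChar.zero_apply,
      ← eq_sub_iff_add_eq'] at h
    rw [h, sub_eq_zero]
    split_ifs <;> simp [mul_sub, hNC]
  have hcs := sq_sum_le_card_mul_sum_sq (s := Finset.univ.erase (0 : AddChar R ℂ))
    (f := fun ψ : AddChar R ℂ => ‖∑ y ∈ E, ψ (x ⬝ᵥ y - α)‖)
  rw [← sq_abs, ← Real.norm_eq_abs, ← Complex.norm_real, hexp, norm_mul, norm_inv,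
    Complex.norm_natCast, mul_pow]
  generalize (Fintype.card R : ℝ) = N at *
  calc (N⁻¹) ^ 2 * ‖∑ ψ ∈ Finset.univ.erase (0 : AddChar R ℂ), ∑ y ∈ E, ψ (x ⬝ᵥ y - α)‖ ^ 2
      ≤ (N⁻¹) ^ 2 *
          (∑ ψ ∈ Finset.univ.erase (0 : AddChar R ℂ), ‖∑ y ∈ E, ψ (x ⬝ᵥ y - α)‖) ^ 2 := by
        gcongr
        exact norm_sum_le _ _
    _ ≤ (N⁻¹) ^ 2 *
          (N * ∑ ψ ∈ Finset.univ.erase (0 : AddChar R ℂ), ‖∑ y ∈ E, ψ (x ⬝ᵥ y - α)‖ ^ 2) := by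
        gcongr
        refine hcs.trans ?_
        gcongr
    _ = _ := by field_simp

open Classical in
/-- Discrepancy of the incidence relation `x ⬝ᵥ y = α` on `R ^ d`, in mean square over `x`. -/
theorem sum_sq_incidence_discrepancy_le (hd : 1 ≤ d) (E : Finset (Fin d → R)) (α : R) :
    ∑ x ∈ E, (∑ y ∈ E, ((if x ⬝ᵥ y = α then (1 : ℝ) else 0) - (Fintype.card R : ℝ)⁻¹)) ^ 2 ≤
      (Fintype.card R : ℝ) ^ (d - 1) * (Nat.card {a : R // ¬ IsUnit a} : ℝ) ^ (d - 1) *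
        (Nat.card {ab : R × R // ab.1 * ab.2 = 0} : ℝ) * E.card := by
  have hN : (0 : ℝ) < Fintype.card R := by exact_mod_cast Fintype.card_pos
  have hI : ∀ ψ ∈ Finset.univ.erase (0 : AddChar R ℂ), ((kernelIdeal ψ).card : ℝ) ^ d ≤
      (Nat.card {a : R // ¬ IsUnit a} : ℝ) ^ (d - 1) * (kernelIdeal ψ).card := by
    intro ψ hψ
    have h : ((kernelIdeal ψ).card : ℝ) ≤ (Nat.card {a : R // ¬ IsUnit a} : ℝ) :=
      Nat.cast_le.mpr (card_kernelIdeal_le (Finset.ne_of_mem_erase hψ))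
    rw [← pow_sub_one_mul (by omega : d ≠ 0)]
    gcongr
  have hZ : ∑ ψ ∈ Finset.univ.erase (0 : AddChar R ℂ), ((kernelIdeal ψ).card : ℝ) ≤
      (Nat.card {ab : R × R // ab.1 * ab.2 = 0} : ℝ) := by
    rw [← sum_card_kernelIdeal, Nat.cast_sum]
    exact Finset.sum_le_sum_of_subset_of_nonneg (Finset.subset_univ _)
      (fun _ _ _ => Nat.cast_nonneg _)
  have hF : ∀ ψ ∈ Finset.univ.erase (0 : AddChar R ℂ),
      ∑ x : Fin d → R, ‖∑ y ∈ E, ψ (x ⬝ᵥ y - α)‖ ^ 2 ≤ (Fintype.card R : ℝ) ^ d *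
        (E.card * ((Nat.card {a : R // ¬ IsUnit a} : ℝ) ^ (d - 1) * (kernelIdeal ψ).card)) := by
    intro ψ hψ
    refine (sum_norm_sq_exponential_le ψ E α).trans ?_
    have := hI ψ hψ
    gcongr
  have h1 : ∑ x ∈ E,
      (∑ y ∈ E, ((if x ⬝ᵥ y = α then (1 : ℝ) else 0) - (Fintype.card R : ℝ)⁻¹)) ^ 2 ≤
      (Fintype.card R : ℝ)⁻¹ * ∑ ψ ∈ Finset.univ.erase (0 : AddChar R ℂ),
        ∑ x : Fin d → R, ‖∑ y ∈ E, ψ (x ⬝ᵥ y - α)‖ ^ 2 := by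
    rw [Finset.sum_comm, Finset.mul_sum]
    refine (Finset.sum_le_sum_of_subset_of_nonneg (Finset.subset_univ _)
      (fun _ _ _ => sq_nonneg _)).trans ?_
    exact Finset.sum_le_sum fun x _ => sq_incidence_discrepancy_le E α x
  have h2 := Finset.sum_le_sum hF
  have hM : (0 : ℝ) ≤ (Nat.card {a : R // ¬ IsUnit a} : ℝ) ^ (d - 1) := by positivity
  simp only [← Finset.mul_sum] at h2
  generalize (Fintype.card R : ℝ) = N at *
  generalize (Nat.card {a : R // ¬ IsUnit a} : ℝ) = M at *
  generalize (Nat.card {ab : R × R // ab.1 * ab.2 = 0} : ℝ) = Z at *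
  refine h1.trans ((mul_le_mul_of_nonneg_left h2 (inv_nonneg.mpr hN.le)).trans ?_)
  rw [← pow_sub_one_mul (by omega : d ≠ 0) N]
  calc _ = N ^ (d - 1) * M ^ (d - 1) *
        (∑ ψ ∈ Finset.univ.erase (0 : AddChar R ℂ), ((kernelIdeal ψ).card : ℝ)) * E.card := by
        field_simp
    _ ≤ _ := by gcongr

end Fourier

/-! ### Galois rings -/

section GaloisRing

variable {p e k : ℕ} {R : Type*} [CommRing R]

/-- A Galois ring has `p ^ (e * k)` elements. -/
lemma IsGaloisRing.natCard_eq (hR : IsGaloisRing p e k R) : Nat.card R = p ^ (e * k) := by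
  obtain ⟨he, f, hf, hk, -, ⟨φ⟩⟩ := hR
  rw [Nat.card_congr φ.toEquiv, Nat.card_congr (AdjoinRoot.powerBasisAux' hf).equivFun.toEquiv,
    Nat.card_fun, Nat.card_zmod, Nat.card_eq_fintype_card, Fintype.card_fin, hk, pow_mul]

lemma IsGaloisRing.natCast_pow_eq_zero (hR : IsGaloisRing p e k R) : (p : R) ^ e = 0 := by
  obtain ⟨he, f, hf, hk, -, ⟨φ⟩⟩ := hR
  apply φ.injective
  have h : ((p ^ e : ℕ) : ZMod (p ^ e)) = 0 := ZMod.natCast_self _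
  have h' := congrArg (AdjoinRoot.of f) h
  rw [map_natCast, map_zero] at h'
  rw [map_pow, map_natCast, map_zero, ← Nat.cast_pow, h']

/-- The residue map of a Galois ring: a surjection onto a field with `p ^ k` elements whose kernel is
generated by `p`. -/
lemma IsGaloisRing.exists_residue_map (hp : p.Prime) (hR : IsGaloisRing p e k R) :
    ∃ (K : Type) (_ : Field K) (π : R →+* K), Function.Surjective π ∧ Nat.card K = p ^ k ∧
      ∀ a, π a = 0 ↔ (p : R) ∣ a := by
  obtain ⟨he, f, hf, hk, hirr, ⟨φ⟩⟩ := hR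
  have : Fact p.Prime := ⟨hp⟩
  set c := ZMod.castHom (dvd_pow_self p he) (ZMod p) with hc
  have hcs : Function.Surjective c := ZMod.castHom_surjective _
  have : Fact (Irreducible (f.map c)) := ⟨hirr⟩
  have hfm : (f.map c).Monic := hf.map c
  set ρ := AdjoinRoot.map c f (f.map c) dvd_rfl with hρ
  have hmk : ∀ g : (ZMod (p ^ e))[X],
      ρ (AdjoinRoot.mk f g) = AdjoinRoot.mk (f.map c) (g.map c) := by
    intro g
    have h : ρ.comp (AdjoinRoot.mk f) = (AdjoinRoot.mk (f.map c)).comp (Polynomial.mapRingHom c) := by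
      refine Polynomial.ringHom_ext (fun a => ?_) ?_
      · simp [hρ]
      · simp [hρ]
    exact congrArg (fun F : (ZMod (p ^ e))[X] →+* AdjoinRoot (f.map c) => F g) h
  refine ⟨AdjoinRoot (f.map c), inferInstance, ρ.comp φ.toRingHom, ?_, ?_, fun a => ⟨?_, ?_⟩⟩
  · intro b
    obtain ⟨g, rfl⟩ := AdjoinRoot.mk_surjective b
    obtain ⟨g, rfl⟩ := Polynomial.map_surjective c hcs g
    refine ⟨φ.symm (AdjoinRoot.mk f g), ?_⟩
    simp [hmk]
  · rw [Nat.card_congr (AdjoinRoot.powerBasisAux' hfm).equivFun.toEquiv,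
      Nat.card_fun, Nat.card_zmod, Nat.card_eq_fintype_card, Fintype.card_fin,
      hf.natDegree_map, hk]
  · intro ha
    obtain ⟨g, hg⟩ := AdjoinRoot.mk_surjective (φ a)
    have ha' : ρ (φ a) = 0 := ha
    rw [← hg, hmk, AdjoinRoot.mk_eq_zero] at ha'
    obtain ⟨h, hh⟩ := ha'
    obtain ⟨h, rfl⟩ := Polynomial.map_surjective c hcs h
    have hdvd : C (p : ZMod (p ^ e)) ∣ g - f * h := by
      rw [Polynomial.C_dvd_iff_dvd_coeff]
      intro i
      have hi : c ((g - f * h).coeff i) = 0 := by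
        rw [← Polynomial.coeff_map, Polynomial.map_sub, Polynomial.map_mul, hh, sub_self,
          Polynomial.coeff_zero]
      have : NeZero (p ^ e) := ⟨pow_ne_zero _ hp.ne_zero⟩
      rw [← ZMod.natCast_zmod_val ((g - f * h).coeff i)] at hi ⊢
      rw [map_natCast, ZMod.natCast_eq_zero_iff] at hi
      exact Nat.cast_dvd_cast hi
    obtain ⟨r, hr⟩ := hdvd
    refine ⟨φ.symm (AdjoinRoot.mk f r), φ.injective ?_⟩
    have h1 := congrArg (AdjoinRoot.mk f) hr
    rw [map_sub, map_mul, AdjoinRoot.mk_self, zero_mul, sub_zero, hg, map_mul] at h1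
    rw [h1, map_mul, RingEquiv.apply_symm_apply]
    simp
  · rintro ⟨b, rfl⟩
    have h0 : ((p : ℕ) : AdjoinRoot (f.map c)) = 0 := by
      rw [← map_natCast (AdjoinRoot.of (f.map c)), ZMod.natCast_self, map_zero]
    rw [map_mul, map_natCast, h0, zero_mul]

/-- Elements outside the ideal generated by `p` are units. -/
lemma IsGaloisRing.dvd_of_not_isUnit (hp : p.Prime) (hR : IsGaloisRing p e k R) {a : R}
    (ha : ¬ IsUnit a) : (p : R) ∣ a := by
  obtain ⟨K, _, π, hπ, -, hker⟩ := hR.exists_residue_map hp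
  by_contra h
  have h0 : π a ≠ 0 := fun h' => h ((hker a).mp h')
  obtain ⟨b, hb⟩ := hπ (π a)⁻¹
  have h1 : (p : R) ∣ a * b - 1 := by
    rw [← hker, map_sub, map_mul, hb, mul_inv_cancel₀ h0, map_one, sub_self]
  obtain ⟨c, hc⟩ := h1
  have hnil : IsNilpotent ((p : R) * c) := ⟨e, by rw [mul_pow, hR.natCast_pow_eq_zero, zero_mul]⟩
  have : IsUnit (a * b) := by
    rw [show a * b = (p : R) * c + 1 by rw [← hc]; ring]
    exact hnil.isUnit_add_one
  exact ha (isUnit_of_mul_isUnit_left this)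

/-- The filtration by powers of `p`: each step `p ^ i R / p ^ (i + 1) R` is a quotient of the residue
field. -/
lemma IsGaloisRing.card_multiples_le [Finite R] (hp : p.Prime) (hR : IsGaloisRing p e k R)
    {i : ℕ} (hi : i ≤ e) : Nat.card {a : R // (p : R) ^ i ∣ a} ≤ p ^ (k * (e - i)) := by
  obtain ⟨K, _, π, hπ, hK, hker⟩ := hR.exists_residue_map hp
  have : Finite K := Finite.of_surjective π hπ
  induction hi using Nat.decreasingInduction with
  | self =>
    have : Subsingleton {a : R // (p : R) ^ e ∣ a} := by
      refine ⟨fun ⟨a, ha⟩ ⟨b, hb⟩ => Subtype.ext ?_⟩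
      rw [hR.natCast_pow_eq_zero, zero_dvd_iff] at ha hb
      exact ha.trans hb.symm
    simpa using Finite.card_le_one_iff_subsingleton.mpr this
  | of_succ i hi ih =>
    choose σ hσ using hπ
    let F : K × {a : R // (p : R) ^ (i + 1) ∣ a} → {a : R // (p : R) ^ i ∣ a} := fun z =>
      ⟨(p : R) ^ i * σ z.1 + z.2.1,
        dvd_add (dvd_mul_right _ _) ((pow_dvd_pow _ (Nat.le_succ i)).trans z.2.2)⟩
    have hF : Function.Surjective F := by
      rintro ⟨_, r, rfl⟩
      have h : (p : R) ∣ r - σ (π r) := by rw [← hker, map_sub, hσ, sub_self]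
      refine ⟨(π r, ⟨(p : R) ^ i * (r - σ (π r)), ?_⟩), ?_⟩
      · rw [pow_succ]; exact mul_dvd_mul_left _ h
      · apply Subtype.ext
        simp only [F]
        ring
    calc _ ≤ Nat.card (K × {a : R // (p : R) ^ (i + 1) ∣ a}) := Nat.card_le_card_of_surjective F hF
      _ ≤ p ^ k * p ^ (k * (e - (i + 1))) := by
        rw [Nat.card_prod, hK]; gcongr
      _ = p ^ (k * (e - i)) := by
        rw [← pow_add, show e - i = e - (i + 1) + 1 by omega]; ring

lemma IsGaloisRing.card_nonunits_le [Finite R] (hp : p.Prime) (he : 1 ≤ e)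
    (hR : IsGaloisRing p e k R) : Nat.card {a : R // ¬ IsUnit a} ≤ p ^ (k * (e - 1)) := by
  refine le_trans ?_ (hR.card_multiples_le hp he)
  refine Nat.card_le_card_of_injective
    (fun a => ⟨a.1, by simpa using hR.dvd_of_not_isUnit hp a.2⟩) ?_
  intro a b h
  exact Subtype.ext (congrArg (fun z => z.1) h)

/-- Every element is a power of `p` times a unit, or divisible by `p ^ e` and hence zero. -/
lemma IsGaloisRing.exists_eq_pow_mul_unit (hp : p.Prime) (hR : IsGaloisRing p e k R) (a : R) :
    (p : R) ^ e ∣ a ∨ ∃ i < e, ∃ u : Rˣ, a = (p : R) ^ i * u := by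
  by_cases h : ∃ i < e, ∃ u : Rˣ, a = (p : R) ^ i * u
  · exact Or.inr h
  · refine Or.inl ?_
    have : ∀ i ≤ e, (p : R) ^ i ∣ a := by
      intro i
      induction i with
      | zero => simp
      | succ i ih =>
        intro hi
        obtain ⟨r, rfl⟩ := ih (by omega)
        rw [pow_succ]
        refine mul_dvd_mul_left _ (hR.dvd_of_not_isUnit hp ?_)
        rintro ⟨u, rfl⟩
        exact h ⟨i, by omega, u, rfl⟩
    exact this e le_rfl

/-- The exponent of `p` in a Galois ring is at least `e`: as `1 ≤ k = deg f`, constants embed in the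
quotient by `f`. -/
lemma IsGaloisRing.le_of_pow_eq_zero (hp : p.Prime) (hk : 1 ≤ k)
    (hR : IsGaloisRing p e k R) {i : ℕ} (hi : (p : R) ^ i = 0) : e ≤ i := by
  obtain ⟨he, f, hf, hfk, -, ⟨φ⟩⟩ := hR
  by_contra hlt
  have h1 : AdjoinRoot.mk f (C ((p : ZMod (p ^ e)) ^ i)) = 0 := by
    have := congrArg φ hi
    simpa using this
  refine AdjoinRoot.mk_ne_zero_of_natDegree_lt hf ?_ (by rw [natDegree_C]; omega) h1
  rw [Ne, C_eq_zero, ← Nat.cast_pow, ZMod.natCast_eq_zero_iff, Nat.pow_dvd_pow_iff_le_right hp.one_lt]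
  omega

/-- If `a * b = 0` in a Galois ring, the exponents of `p` in `a` and `b` add up to at least `e`. -/
lemma IsGaloisRing.exists_dvd_of_mul_eq_zero (hp : p.Prime) (hk : 1 ≤ k)
    (hR : IsGaloisRing p e k R) {a b : R} (hab : a * b = 0) :
    ∃ i ≤ e, (p : R) ^ i ∣ a ∧ (p : R) ^ (e - i) ∣ b := by
  rcases hR.exists_eq_pow_mul_unit hp a with ha | ⟨i, hi, u, rfl⟩
  · exact ⟨e, le_rfl, ha, by simp⟩
  rcases hR.exists_eq_pow_mul_unit hp b with hb | ⟨j, hj, v, rfl⟩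
  · exact ⟨0, Nat.zero_le _, by simp, by simpa using hb⟩
  refine ⟨i, hi.le, dvd_mul_right _ _, (pow_dvd_pow _ ?_).mul_right _⟩
  have h : (p : R) ^ (i + j) = 0 := by
    rw [show (p : R) ^ i * u * ((p : R) ^ j * v) = (p : R) ^ (i + j) * ((u * v : Rˣ) : R) by
      rw [pow_add, Units.val_mul]; ring] at hab
    exact (Units.mul_left_eq_zero _).mp hab
  have := hR.le_of_pow_eq_zero hp hk h
  omega

/-- There are at most `(e + 1) |R|` pairs with product zero: they are covered by the sets
`p ^ i R × p ^ (e - i) R` for `i ≤ e`, each of size at most `|R|`. -/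
lemma IsGaloisRing.card_mul_eq_zero_le [Finite R] (hp : p.Prime) (hk : 1 ≤ k)
    (hR : IsGaloisRing p e k R) :
    Nat.card {ab : R × R // ab.1 * ab.2 = 0} ≤ (e + 1) * p ^ (e * k) := by
  let Y : Fin (e + 1) → Type _ := fun i =>
    {a : R // (p : R) ^ (i : ℕ) ∣ a} × {b : R // (p : R) ^ (e - i) ∣ b}
  have hY : ∀ i, Nat.card (Y i) ≤ p ^ (e * k) := by
    intro i
    have hi : (i : ℕ) ≤ e := by omega
    rw [Nat.card_prod]
    calc _ ≤ p ^ (k * (e - i)) * p ^ (k * (e - (e - i))) :=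
          Nat.mul_le_mul (hR.card_multiples_le hp hi) (hR.card_multiples_le hp (Nat.sub_le _ _))
      _ = p ^ (e * k) := by
        rw [← pow_add, ← mul_add, mul_comm e k]
        congr 2
        omega
  have hinj : ∃ F : {ab : R × R // ab.1 * ab.2 = 0} → Σ i, Y i, Function.Injective F := by
    have h : ∀ z : {ab : R × R // ab.1 * ab.2 = 0}, ∃ i : Fin (e + 1),
        (p : R) ^ (i : ℕ) ∣ z.1.1 ∧ (p : R) ^ (e - i) ∣ z.1.2 := by
      intro z
      obtain ⟨i, hi, h⟩ := hR.exists_dvd_of_mul_eq_zero hp hk z.2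
      exact ⟨⟨i, by omega⟩, h⟩
    choose ι h₁ h₂ using h
    refine ⟨fun z => ⟨ι z, ⟨z.1.1, h₁ z⟩, ⟨z.1.2, h₂ z⟩⟩, ?_⟩
    intro z w hzw
    have h1 := congrArg (fun s : Σ i, Y i => s.2.1.1) hzw
    have h2 := congrArg (fun s : Σ i, Y i => s.2.2.1) hzw
    exact Subtype.ext (Prod.ext h1 h2)
  obtain ⟨F, hF⟩ := hinj
  calc _ ≤ Nat.card (Σ i, Y i) := Nat.card_le_card_of_injective F hF
    _ = ∑ i, Nat.card (Y i) := Nat.card_sigma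
    _ ≤ ∑ _i : Fin (e + 1), p ^ (e * k) := Finset.sum_le_sum fun i _ => hY i
    _ = _ := by simp

end GaloisRing

/-! ### Dot products over Galois rings -/

/-- The dot product as a function of an unordered pair of vectors. -/
def sym2Dot {R : Type*} [CommRing R] {d : ℕ} : Sym2 (Fin d → R) → R :=
  Sym2.lift ⟨fun x y => x ⬝ᵥ y, dotProduct_comm⟩

@[simp] lemma sym2Dot_mk {R : Type*} [CommRing R] {d : ℕ} (x y : Fin d → R) :
    sym2Dot s(x, y) = x ⬝ᵥ y := rfl

/-- The mean-square incidence discrepancy over a Galois ring. -/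
theorem IsGaloisRing.sum_sq_incidence_discrepancy_le {R : Type*} [CommRing R] {p e k d : ℕ}
    (hp : p.Prime) (he : 1 ≤ e) (hk : 1 ≤ k) (hd : 1 ≤ d) (hR : IsGaloisRing p e k R)
    (E : Finset (Fin d → R)) (α : R) [DecidableEq R] :
    ∑ x ∈ E, (∑ y ∈ E, ((if x ⬝ᵥ y = α then (1 : ℝ) else 0) - ((p : ℝ) ^ (e * k))⁻¹)) ^ 2 ≤
      ((p : ℝ) ^ (e * k)) ^ (d - 1) * ((p : ℝ) ^ (k * (e - 1))) ^ (d - 1) *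
        ((e + 1) * (p : ℝ) ^ (e * k)) * E.card := by
  have hcard := hR.natCard_eq
  have : Finite R := Nat.finite_of_card_ne_zero (by rw [hcard]; exact pow_ne_zero _ hp.ne_zero)
  have := Fintype.ofFinite R
  rw [Nat.card_eq_fintype_card] at hcard
  have h := _root_.sum_sq_incidence_discrepancy_le hd E α
  have hN : (Fintype.card R : ℝ) = (p : ℝ) ^ (e * k) := by exact_mod_cast hcard
  have hM : (Nat.card {a : R // ¬ IsUnit a} : ℝ) ≤ (p : ℝ) ^ (k * (e - 1)) := by
    exact_mod_cast hR.card_nonunits_le hp he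
  have hZ : (Nat.card {ab : R × R // ab.1 * ab.2 = 0} : ℝ) ≤ (e + 1) * (p : ℝ) ^ (e * k) := by
    exact_mod_cast hR.card_mul_eq_zero_le hp hk
  rw [hN] at h
  refine le_trans (le_of_eq ?_) (h.trans ?_)
  · refine Finset.sum_congr rfl fun x _ => congrArg (· ^ 2) (Finset.sum_congr rfl fun y _ => ?_)
    split_ifs <;> rfl
  · gcongr

/-! ### Size conditions and the bound for forests -/

/-- The first lower bound on the size of the set, squared and freed of half-integral exponents. -/
lemma sq_lower_bound_edge {p e k d n : ℕ} (hp : 0 < p) (hd : 1 ≤ d) {c : ℝ}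
    (h : 2 * (n : ℝ) * √(6 + 3 * (e : ℝ)) *
      (p : ℝ) ^ ((d : ℝ) * e * k - (d : ℝ) * k / 2 + 3 * (e : ℝ) * k / 2 + (k : ℝ) / 2) ≤ c) :
    4 * (n : ℝ) ^ 2 * (6 + 3 * e) * ((p : ℝ) ^ (e * k)) ^ (2 * d + 3) ≤
      c ^ 2 * ((p : ℝ) ^ k) ^ (d - 1) := by
  have hp' : (0 : ℝ) < p := by exact_mod_cast hp
  have h2 := pow_le_pow_left₀ (by positivity) h 2
  rw [mul_pow, mul_pow, Real.sq_sqrt (by positivity), ← Real.rpow_mul_natCast hp'.le] at h2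
  refine le_trans (le_of_eq ?_) (mul_le_mul_of_nonneg_right h2 (by positivity))
  rw [mul_assoc _ ((p : ℝ) ^ (_ : ℝ)), ← pow_mul, ← pow_mul,
    ← Real.rpow_natCast (p : ℝ) (k * (d - 1)), ← Real.rpow_natCast (p : ℝ) (e * k * (2 * d + 3)),
    ← Real.rpow_add hp']
  congr 1
  · ring
  · congr 1
    push_cast [hd]
    ring

/-- The second lower bound on the size of the set, squared and freed of half-integral exponents. -/
lemma sq_lower_bound_forest {p e k d n : ℕ} (hp : 0 < p) (hd : 1 ≤ d) {c : ℝ}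
    (h : √(14 * (e : ℝ)) *
      (p : ℝ) ^ ((d : ℝ) * e * k - (d : ℝ) * k / 2 + (n : ℝ) * e * k / 2 + (n : ℝ) / 2
            - (e : ℝ) * k / 2 + (k : ℝ) / 2) ≤ c) :
    14 * (e : ℝ) * (((p : ℝ) ^ (e * k)) ^ (2 * d + n) * (p : ℝ) ^ n) ≤
      c ^ 2 * (((p : ℝ) ^ k) ^ (d - 1) * (p : ℝ) ^ (e * k)) := by
  have hp' : (0 : ℝ) < p := by exact_mod_cast hp
  have h2 := pow_le_pow_left₀ (by positivity) h 2
  rw [mul_pow, Real.sq_sqrt (by positivity), ← Real.rpow_mul_natCast hp'.le] at h2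
  refine le_trans (le_of_eq ?_) (mul_le_mul_of_nonneg_right h2 (by positivity))
  rw [mul_assoc _ ((p : ℝ) ^ (_ : ℝ)), ← pow_mul, ← pow_mul, ← pow_add, ← pow_add,
    ← Real.rpow_natCast (p : ℝ) (k * (d - 1) + e * k),
    ← Real.rpow_natCast (p : ℝ) (e * k * (2 * d + n) + n), ← Real.rpow_add hp']
  congr 2
  push_cast [hd]
  ring

/-- The configurations are counted by a sum over `E ^ V` of a product over the edges. The edge labels
are extended to all unordered pairs, so that subsets of the edge set can be treated uniformly. -/
lemma ncard_dotConfigurations_le {R V : Type*} [CommRing R] [DecidableEq R] [Fintype V]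
    [DecidableEq V] {d : ℕ} {T : SimpleGraph V} {α : T.edgeSet → R} {E : Finset (Fin d → R)}
    {S : Finset (Sym2 V)} (hS : (S : Set (Sym2 V)) = T.edgeSet) {β : Sym2 V → R}
    (hβ : ∀ ε : T.edgeSet, β ε = α ε) :
    ((dotConfigurations T α E).ncard : ℝ) ≤ ∑ x ∈ Fintype.piFinset (fun _ : V => E),
      ∏ ε ∈ S, if sym2Dot (ε.map x) = β ε then (1 : ℝ) else 0 := by
  classical
  have hsub : dotConfigurations T α E ⊆ ((Fintype.piFinset (fun _ : V => E)).filter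
      fun x => ∀ ε ∈ S, sym2Dot (ε.map x) = β ε : Finset (V → Fin d → R)) := by
    rintro x ⟨hx, hxα⟩
    simp only [Finset.coe_filter, Fintype.mem_piFinset, Set.mem_ofPred_eq]
    refine ⟨hx, fun ε hε => ?_⟩
    have hε' : ε ∈ T.edgeSet := hS ▸ Finset.mem_coe.mpr hε
    induction ε with | _ u v
    rw [hβ ⟨s(u, v), hε'⟩, Sym2.map_mk, sym2Dot_mk]
    exact hxα u v hε'
  have h := Set.ncard_le_ncard hsub (Finset.finite_toSet _)
  rw [Set.ncard_coe_finset] at h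
  calc ((dotConfigurations T α E).ncard : ℝ) ≤ _ := Nat.cast_le.mpr h
    _ = _ := by
      rw [Finset.card_filter]
      push_cast
      exact Finset.sum_congr rfl fun x _ => by
        rw [Finset.prod_ite_zero, Finset.prod_const_one]
        split_ifs <;> rfl

/-- With `c = |E|`, `N = |R|` and `Q` the size of the residue field, both error terms of the forest
count are at most half of the main term. -/
lemma error_terms_le {N Q p c η : ℝ} {e d n : ℕ} (hd : 1 ≤ d) (he : 5 ≤ e) (hN : 1 ≤ N)
    (hQ : 0 < Q) (hp : 2 ≤ p) (hc : 0 < c)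
    (hηQ : (η * c) ^ 2 * Q ^ (d - 1) = (e + 1) * N ^ (2 * d - 1))
    (h1 : 4 * (n : ℝ) ^ 2 * (6 + 3 * e) * N ^ (2 * d + 3) ≤ c ^ 2 * Q ^ (d - 1))
    (h2 : 14 * (e : ℝ) * (N ^ (2 * d + n) * p ^ n) ≤ c ^ 2 * (Q ^ (d - 1) * N)) :
    n * η * N ≤ 1 / 2 ∧ η ^ 2 * (N + 1) ^ n ≤ 1 / 2 := by
  have he' : (5 : ℝ) ≤ e := by exact_mod_cast he
  have hN0 : 0 < N := by linarith
  have hcQ : 0 < c ^ 2 * Q ^ (d - 1) := by positivity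
  constructor
  · refine abs_le_of_sq_le_sq' ?_ (by norm_num) |>.2
    refine le_of_mul_le_mul_right ?_ hcQ
    calc (n * η * N) ^ 2 * (c ^ 2 * Q ^ (d - 1))
        = n ^ 2 * N ^ 2 * ((η * c) ^ 2 * Q ^ (d - 1)) := by ring
      _ = n ^ 2 * (e + 1) * N ^ (2 * d - 1 + 2) := by rw [hηQ]; ring
      _ ≤ n ^ 2 * (6 + 3 * e) * N ^ (2 * d + 3) := by
        gcongr ?_ ^ 2 * ?_ * ?_
        · linarith
        · exact pow_le_pow_right₀ hN (by omega)
      _ = (1 / 2) ^ 2 * (4 * (n : ℝ) ^ 2 * (6 + 3 * e) * N ^ (2 * d + 3)) := by ring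
      _ ≤ _ := by gcongr
  · refine le_of_mul_le_mul_right ?_ (mul_pos hcQ hN0)
    have hpow : (N + 1) ^ n ≤ N ^ n * p ^ n := by
      rw [← mul_pow]
      gcongr
      nlinarith
    calc η ^ 2 * (N + 1) ^ n * (c ^ 2 * Q ^ (d - 1) * N)
        = (η * c) ^ 2 * Q ^ (d - 1) * N * (N + 1) ^ n := by ring
      _ = (e + 1) * N ^ (2 * d - 1 + 1) * (N + 1) ^ n := by rw [hηQ]; ring
      _ = (e + 1) * N ^ (2 * d) * (N + 1) ^ n := by
        rw [show 2 * d - 1 + 1 = 2 * d by omega]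
      _ ≤ (7 * e) * N ^ (2 * d) * (N ^ n * p ^ n) := by
        gcongr
        linarith
      _ = 1 / 2 * (14 * (e : ℝ) * (N ^ (2 * d + n) * p ^ n)) := by ring
      _ ≤ 1 / 2 * (c ^ 2 * (Q ^ (d - 1) * N)) := by gcongr
      _ = _ := by ring

theorem theorem1p1 {R V : Type*} [CommRing R] [Fintype V]
    (p e k d m n : ℕ) (hp : p.Prime) (hd : 3 ≤ d) (he : 5 ≤ e) (hk : 1 ≤ k) (hn : 3 ≤ n)
    (hR : IsGaloisRing p e k R) (E : Finset (Fin d → R))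
    (T : SimpleGraph V) (hT : T.IsAcyclic) (hm : Fintype.card V = m)
    (hTn : T.edgeSet.ncard = n) (α : T.edgeSet → R)
    (hE : max
        (2 * (n : ℝ) * √(6 + 3 * (e : ℝ)) *
          (p : ℝ) ^ ((d : ℝ) * e * k - (d : ℝ) * k / 2 + 3 * (e : ℝ) * k / 2 + (k : ℝ) / 2))
        (√(14 * (e : ℝ)) *
          (p : ℝ) ^ ((d : ℝ) * e * k - (d : ℝ) * k / 2 + (n : ℝ) * e * k / 2 + (n : ℝ) / 2
            - (e : ℝ) * k / 2 + (k : ℝ) / 2))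
      ≤ (E.card : ℝ)) :
    ((dotConfigurations T α E).ncard : ℝ) ≤ 2 * (E.card : ℝ) ^ m / (p : ℝ) ^ (n * e * k) := by
  classical
  subst hm
  have hp0 : (0 : ℝ) < p := by exact_mod_cast hp.pos
  have hp2 : (2 : ℝ) ≤ p := by exact_mod_cast hp.two_le
  have hc : (0 : ℝ) < E.card := by
    refine lt_of_lt_of_le ?_ ((le_max_right _ _).trans hE)
    have : (0 : ℝ) < e := by exact_mod_cast (by omega : 0 < e)
    positivity
  have hEne : E.Nonempty := Finset.card_pos.mp (by exact_mod_cast hc)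
  have h1 := sq_lower_bound_edge hp.pos (by omega : 1 ≤ d) ((le_max_left _ _).trans hE)
  have h2 := sq_lower_bound_forest hp.pos (by omega : 1 ≤ d) ((le_max_right _ _).trans hE)
  obtain ⟨S, hS⟩ : ∃ S : Finset (Sym2 V), (S : Set (Sym2 V)) = T.edgeSet :=
    ⟨T.edgeFinset, T.coe_edgeFinset⟩
  have hSn : S.card = n := by rw [← hTn, ← hS, Set.ncard_coe_finset]
  let β : Sym2 V → R := fun ε => if h : ε ∈ T.edgeSet then α ⟨ε, h⟩ else 0
  have hβ : ∀ ε : T.edgeSet, β ε = α ε := fun ε => by simp [β]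
  have hcount := ncard_dotConfigurations_le (E := E) hS hβ
  set c : ℝ := (E.card : ℝ) with hcdef
  set N : ℝ := (p : ℝ) ^ (e * k) with hNdef
  have hN1 : 1 ≤ N := one_le_pow₀ (by linarith)
  have hN0 : 0 < N := by linarith
  -- `L` is the mean-square incidence discrepancy over `E`; `η` is its root relative to `|E|`.
  let L : ℝ := N ^ (d - 1) * ((p : ℝ) ^ (k * (e - 1))) ^ (d - 1) * ((e + 1) * N)
  have hL0 : 0 ≤ L := by positivity
  let η : ℝ := √L / c
  have hη0 : 0 ≤ η := by positivity
  have hηc : (η * c) ^ 2 = L := by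
    simp only [η]
    rw [div_mul_cancel₀ _ hc.ne', Real.sq_sqrt hL0]
  have hηQ : (η * c) ^ 2 * ((p : ℝ) ^ k) ^ (d - 1) = (e + 1) * N ^ (2 * d - 1) := by
    have hNQ : (p : ℝ) ^ (k * (e - 1)) * (p : ℝ) ^ k = N := by
      rw [← pow_add, hNdef]
      congr 1
      obtain ⟨e, rfl⟩ := Nat.exists_eq_add_of_le' (by omega : 1 ≤ e)
      simp only [Nat.add_sub_cancel]
      ring
    calc (η * c) ^ 2 * ((p : ℝ) ^ k) ^ (d - 1)
        = N ^ (d - 1) * ((p : ℝ) ^ (k * (e - 1)) * (p : ℝ) ^ k) ^ (d - 1) * ((e + 1) * N) := by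
          rw [hηc, mul_pow]; simp only [L]; ring
      _ = (e + 1) * N ^ (d - 1 + (d - 1) + 1) := by rw [hNQ]; ring
      _ = _ := by rw [show d - 1 + (d - 1) + 1 = 2 * d - 1 by omega]
  obtain ⟨herr1, herr2⟩ :=
    error_terms_le (by omega : 1 ≤ d) he hN1 (by positivity) hp2 hc hηQ h1 h2
  let κ : Sym2 V → Sym2 (Fin d → R) → ℝ := fun ε z =>
    (if sym2Dot z = β ε then 1 else 0) - N⁻¹
  have hinv0 : 0 ≤ N⁻¹ := by positivity
  have hinv1 : N⁻¹ ≤ 1 := inv_le_one_of_one_le₀ hN1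
  have hκ1 : ∀ ε z, |κ ε z| ≤ 1 := by
    intro ε z
    simp only [κ]
    rw [abs_le]
    split_ifs <;> constructor <;> linarith
  have hκ : ∀ ε ∈ S, ∑ z ∈ E, (∑ y ∈ E, κ ε s(y, z)) ^ 2 ≤ (η * E.card) ^ 2 * E.card := by
    intro ε _
    rw [← hcdef, hηc]
    have h := hR.sum_sq_incidence_discrepancy_le hp (by omega) hk (by omega : 1 ≤ d) E (β ε)
    simp only [κ, sym2Dot_mk]
    simpa only [dotProduct_comm] using h
  have hforest := sum_prod_forest_le hEne (S := S)
    (by rw [hS, SimpleGraph.fromEdgeSet_edgeSet]; exact hT)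
    (fun ε hε => T.not_isDiag_of_mem_edgeSet (hS ▸ Finset.mem_coe.mpr hε)) hκ1 hη0 hinv0 hκ
  simp only [κ, sub_add_cancel, hSn] at hforest
  refine (hcount.trans hforest).trans ?_
  have hpn : (p : ℝ) ^ (n * e * k) = N ^ n := by
    rw [hNdef, ← pow_mul]
    congr 1
    ring
  have hn1 : N⁻¹ ^ (n - 1) = N * N⁻¹ ^ n := by
    rw [← pow_sub_one_mul (by omega : n ≠ 0) N⁻¹]
    field_simp
  have h1N : (1 + N⁻¹) ^ n = (N + 1) ^ n * N⁻¹ ^ n := by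
    rw [← mul_pow]
    congr 1
    field_simp
  rw [hpn, hn1, h1N, ← hcdef]
  calc c ^ Fintype.card V * (N⁻¹ ^ n + n * (η * (N * N⁻¹ ^ n)) + η ^ 2 * ((N + 1) ^ n * N⁻¹ ^ n))
      = c ^ Fintype.card V * N⁻¹ ^ n * (1 + n * η * N + η ^ 2 * (N + 1) ^ n) := by ring
    _ ≤ c ^ Fintype.card V * N⁻¹ ^ n * (1 + 1 / 2 + 1 / 2) := by gcongr
    _ = 2 * c ^ Fintype.card V / N ^ n := by rw [inv_pow]; ring
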